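/- Let $n\ge 3$ be an integer with $n\neq 4$. Let $B_n$ be the Artin braid group with generators $\sigma_1,\dots,\sigma_{n-1}$ and relations $\sigma_i\sigma_{i+1}\sigma_i=\sigma_{i+1}\sigma_i\sigma_{i+1}$ $(1\le i\le n-2)$ and $\sigma_i\sigma_j=\sigma_j\sigma_i$ $(|i-j|\ge 2)$. Let $P_n$ be the pure braid group, i.e. the kernel of the homomorphism $B_n\to\mathfrak S_n$, $\sigma_i\mapsto(i,i+1)$, onto the symmetric group, let $C_n\subset P_n$ be the center of $B_n$, and put $\mathcal B_n=B_n/C_n$ and $\mathcal P_n=P_n/C_n\subset\mathcal B_n$. Let $\widehat{\mathcal B}_n$ and $\widehat{\mathcal P}_n$ be the profinite completions of $\mathcal B_n$ and $\mathcal P_n$, where $\widehat{\mathcal P}_n$ is identified with its image in $\widehat{\mathcal B}_n$ under the homomorphism induced by the inclusion $\mathcal P_n\subset\mathcal B_n$. Then every continuous surjective homomorphism $\widehat{\mathcal B}_n\to\mathfrak S_n$ (where $\mathfrak S_n$ is discrete) has kernel $\widehat{\mathcal P}_n$. In particular, $\widehat{\mathcal P}_n$ is a characteristic subgroup of the profinite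 group $\widehat{\mathcal B}_n$: every automorphism of the topological group $\widehat{\mathcal B}_n$ maps $\widehat{\mathcal P}_n$ onto itself. -/

import Mathlib

namespace ProfiniteBraid

/-- The relators of the Artin presentation on `σ 0, …, σ (n - 2)`:
`σ i σ (i+1) σ i = σ (i+1) σ i σ (i+1)`, and `σ i σ j = σ j σ i` whenever `|i - j| ≥ 2`. -/
def braidRels (n : ℕ) : Set (FreeGroup (Fin (n - 1))) :=
  {r | ∃ i j : Fin (n - 1), (i : ℕ) + 1 = j ∧
      r = (FreeGroup.of i * FreeGroup.of j * FreeGroup.of i) *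
        (FreeGroup.of j * FreeGroup.of i * FreeGroup.of j)⁻¹} ∪
  {r | ∃ i j : Fin (n - 1), (i : ℕ) + 2 ≤ j ∧
      r = (FreeGroup.of i * FreeGroup.of j) * (FreeGroup.of j * FreeGroup.of i)⁻¹}

/-- The Artin braid group `B_n` on `n` strings. -/
abbrev BraidGroup (n : ℕ) : Type := PresentedGroup (braidRels n)

/-- The transposition `(i, i+1)` of `Fin n`. -/
def adjSwap (n : ℕ) (i : Fin (n - 1)) : Equiv.Perm (Fin n) :=
  Equiv.swap ⟨i, by omega⟩ ⟨i + 1, by omega⟩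

theorem adjSwap_rels (n : ℕ) : ∀ r ∈ braidRels n, FreeGroup.lift (adjSwap n) r = 1 := by
  rintro r (⟨i, j, h, rfl⟩ | ⟨i, j, h, rfl⟩)
  · simp only [map_mul, map_inv, FreeGroup.lift_apply_of, mul_inv_eq_one]
    obtain ⟨i, hi⟩ := i
    obtain ⟨j, hj⟩ := j
    simp only at h
    subst h
    simp only [adjSwap]
    rw [Equiv.swap_comm (⟨i + 1, _⟩ : Fin n) ⟨i + 1 + 1, _⟩,
      Equiv.swap_comm (⟨i, _⟩ : Fin n) ⟨i + 1, _⟩,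
      Equiv.swap_mul_swap_mul_swap (by simp) (by simp; omega),
      Equiv.swap_comm (⟨i + 1, _⟩ : Fin n) ⟨i, _⟩,
      Equiv.swap_comm (⟨i + 1 + 1, _⟩ : Fin n) ⟨i + 1, _⟩,
      Equiv.swap_mul_swap_mul_swap (by simp) (by simp; omega), Equiv.swap_comm]
  · simp only [map_mul, map_inv, FreeGroup.lift_apply_of, mul_inv_eq_one]
    refine (Equiv.Perm.Disjoint.commute ?_).eq
    refine Equiv.Perm.disjoint_swap_swap ?_
    simp [Fin.ext_iff]
    omega

/-- The standard homomorphism `B_n → S_n`, sending `σ i` to the transposition `(i, i+1)`. -/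
def braidToPerm (n : ℕ) : BraidGroup n →* Equiv.Perm (Fin n) :=
  PresentedGroup.toGroup (adjSwap_rels n)

/-- The pure braid group `P_n`, as a subgroup of `B_n`. -/
def pureBraidGroup (n : ℕ) : Subgroup (BraidGroup n) := (braidToPerm n).ker

/-- The quotient `𝓑_n = B_n / C_n` of the braid group by its center `C_n`. -/
abbrev BraidModCenter (n : ℕ) : Type := BraidGroup n ⧸ Subgroup.center (BraidGroup n)

/-- The group `𝓟_n = P_n / C_n`, as a subgroup of `𝓑_n` (for `n ≥ 3` the center `C_n` of `B_n`
is contained in `P_n`). -/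
def pureBraidModCenter (n : ℕ) : Subgroup (BraidModCenter n) :=
  (pureBraidGroup n).map (QuotientGroup.mk' (Subgroup.center (BraidGroup n)))

/-- The profinite completion of `𝓑_n`. -/
noncomputable abbrev braidHat (n : ℕ) : ProfiniteGrp.{0} :=
  ProfiniteGrp.profiniteCompletion.obj (GrpCat.of (BraidModCenter n))

/-- The profinite completion of `𝓟_n`. -/
noncomputable abbrev pureBraidCompletion (n : ℕ) : ProfiniteGrp.{0} :=
  ProfiniteGrp.profiniteCompletion.obj (GrpCat.of (pureBraidModCenter n))

/-- The morphism from the profinite completion of `𝓟_n` to that of `𝓑_n` induced by the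
inclusion of `𝓟_n` in `𝓑_n`. -/
noncomputable def pureBraidCompletionMap (n : ℕ) : pureBraidCompletion n ⟶ braidHat n :=
  ProfiniteGrp.profiniteCompletion.map (GrpCat.ofHom (pureBraidModCenter n).subtype)

/-- The profinite completion of `𝓟_n`, regarded as a subgroup of the profinite completion
of `𝓑_n`. -/
noncomputable def pureBraidHat (n : ℕ) : Subgroup (braidHat n) :=
  (pureBraidCompletionMap n).hom.toMonoidHom.range

/-- The symmetric group `S_n` as a (discrete) profinite group. -/
abbrev symmetricProfinite (n : ℕ) : ProfiniteGrp.{0} :=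
  ProfiniteGrp.ofFiniteGrp (FiniteGrp.of (Equiv.Perm (Fin n)))

/-- A subgroup of a profinite group is characteristic if it is preserved by every automorphism
of the profinite group, that is, by every automorphism of topological groups. -/
def IsCharacteristic {G : ProfiniteGrp.{0}} (H : Subgroup G) : Prop :=
  ∀ φ : G ≃ₜ* G, H.map φ.toMulEquiv.toMonoidHom = H

end ProfiniteBraid

/-! By density the theorem reduces to the discrete one: every epimorphism `f` from the braid group
onto the symmetric group has the pure braid group as kernel. The main input is a counting bound
(`factorial_mul_orderOf_le`). Suppose a finite group `G` contains elements `a i` that satisfy the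
Artin relations, neighbours not commuting, and let `r` be the order of `a 0`. The band generators
are conjugates of `a 0`, told apart by which `a m` they commute with, so for `n ≠ 4` the class of `a
0` has at least `n.choose 2` elements. The centralizer of `a 0` modulo `⟨a 0⟩` contains a braid
tuple on `n - 2` strings, so by induction it has order at least `(n - 2)!`. Multiplying gives `n! *
r ≤ 2 * |G|`. The step from 6 to 4 strings needs a separate argument. For `G` symmetric this forces
`r ≤ 2`, so `f` sends the Artin generators to involutions. The product of `f` with the standard map
then has image of order at most `n!` (`card_initialClosure_le`, the Coxeter bound). Both projections
of this image onto the symmetric group are therefore bijective, and the two kernels agree. -/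

section BraidTuples

-- Braid tuples and their band generators.

universe u

variable {G : Type u} [Group G]

/-- A sequence whose first `n - 1` terms satisfy the Artin relations of the braid group on `n`
strings, consecutive terms being non-commuting. -/
structure IsBraidTuple (n : ℕ) (a : ℕ → G) : Prop where
  braid : ∀ i, i + 2 < n → a i * a (i + 1) * a i = a (i + 1) * a i * a (i + 1)
  comm : ∀ i j, i + 2 ≤ j → j + 1 < n → Commute (a i) (a j)
  not_comm : ∀ i, i + 2 < n → ¬ Commute (a i) (a (i + 1))

/-- The band generator exchanging the strings `i` and `i + k + 1`. -/
def bandGenerator (a : ℕ → G) (i : ℕ) : ℕ → G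
  | 0 => a i
  | k + 1 => a (i + k + 1) * bandGenerator a i k * (a (i + k + 1))⁻¹

theorem commute_conj_iff {x c y : G} (h : Commute x c) :
    Commute x (c * y * c⁻¹) ↔ Commute x y := by
  have hx : x = c * x * c⁻¹ := by rw [← h.eq]; group
  conv_lhs => rw [hx]
  exact Commute.conj_iff c

theorem commute_inv_conj_iff {x c y : G} (h : Commute x c) :
    Commute x (c⁻¹ * y * c) ↔ Commute x y := by
  simpa using commute_conj_iff (y := y) h.inv_right

theorem eq_of_braid_of_commute {x y : G} (h : x * y * x = y * x * y) (hc : Commute x y) :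
    x = y := by
  rw [hc.eq] at h
  simpa using h

namespace IsBraidTuple

variable {n : ℕ} {a : ℕ → G} (h : IsBraidTuple n a)
include h

/-- The defining recursion moves the right string; this one moves the left string, which is what
arguments at the left end need. -/
theorem bandGenerator_succ (i k : ℕ) (hk : i + k + 2 < n) :
    bandGenerator a i (k + 1) = (a i)⁻¹ * bandGenerator a (i + 1) k * a i := by
  induction k with
  | zero =>
    have := h.braid i (by omega)
    simp only [bandGenerator, Nat.add_zero]
    rw [mul_inv_eq_iff_eq_mul, mul_assoc, mul_assoc, eq_inv_mul_iff_mul_eq, ← mul_assoc,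
      ← mul_assoc, this]
  | succ k ih =>
    have hc : Commute (a i) (a (i + (k + 1) + 1)) := h.comm _ _ (by omega) (by omega)
    rw [bandGenerator, ih (by omega), bandGenerator, show i + 1 + k + 1 = i + (k + 1) + 1 by omega]
    have h1 := hc.inv_left.eq
    have h2 := hc.inv_right.eq
    calc _ = (a (i + (k + 1) + 1) * (a i)⁻¹) * bandGenerator a (i + 1) k *
          (a i * (a (i + (k + 1) + 1))⁻¹) := by group
      _ = _ := by rw [← h1, h2]; group

theorem commute_of_lt (m i k : ℕ) (hm : m + 1 < i) (hk : i + k + 1 < n) :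
    Commute (a m) (bandGenerator a i k) := by
  induction k with
  | zero => exact h.comm _ _ (by omega) (by omega)
  | succ k ih =>
    rw [bandGenerator, commute_conj_iff (h.comm _ _ (by omega) (by omega))]
    exact ih (by omega)

theorem commute_of_gt (m i k : ℕ) (hm : i + k + 1 < m) (hk : m + 1 < n) :
    Commute (a m) (bandGenerator a i k) := by
  induction k with
  | zero => exact (h.comm _ _ (by omega) (by omega)).symm
  | succ k ih =>
    rw [bandGenerator, commute_conj_iff (h.comm _ _ (by omega) (by omega)).symm]
    exact ih (by omega)

theorem not_commute_left (m k : ℕ) (hk : m + 1 + k + 1 < n) :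
    ¬ Commute (a m) (bandGenerator a (m + 1) k) := by
  induction k with
  | zero => exact h.not_comm _ (by omega)
  | succ k ih =>
    rw [bandGenerator, commute_conj_iff (h.comm _ _ (by omega) (by omega))]
    exact ih (by omega)

theorem not_commute_right (i k : ℕ) (hk : i + k + 2 < n) :
    ¬ Commute (a (i + k + 1)) (bandGenerator a i k) := by
  induction k generalizing i with
  | zero => exact fun hc => h.not_comm _ (by omega) hc.symm
  | succ k ih =>
    rw [h.bandGenerator_succ _ _ (by omega),
      commute_inv_conj_iff (h.comm _ _ (by omega) (by omega)).symm]
    simpa [show i + 1 + k + 1 = i + (k + 1) + 1 by omega] using ih (i + 1) (by omega)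

theorem commute_between (i l r : ℕ) (hk : i + l + r + 3 < n) :
    Commute (a (i + l + 1)) (bandGenerator a i (l + 2 + r)) := by
  induction r with
  | zero =>
    have hb := h.braid (i + l + 1) (by omega)
    have hc := h.commute_of_gt (i + l + 2) i l (by omega) (by omega)
    simp only [bandGenerator, show i + (l + 1) + 1 = i + l + 2 by omega]
    rw [show i + l + 1 + 1 = i + l + 2 by omega] at hb
    generalize a (i + l + 1) = x at *
    generalize a (i + l + 2) = y at *
    generalize bandGenerator a i l = z at *
    -- Conjugation by `y * x` carries `y` to `x` by the braid relation, and `z` to the band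
    -- generator; `y` and `z` have disjoint strings, so they commute.
    have e : y * (x * z * x⁻¹) * y⁻¹ = (y * x) * z * (y * x)⁻¹ := by group
    have hx : x = (y * x) * y * (y * x)⁻¹ := by
      rw [eq_mul_inv_iff_mul_eq, ← mul_assoc, hb]
    rw [e]
    conv_lhs => rw [hx]
    exact (Commute.conj_iff _).2 hc
  | succ r ih =>
    rw [← Nat.add_assoc (l + 2), bandGenerator,
      commute_conj_iff (h.comm _ _ (by omega) (by omega))]
    exact ih (by omega)

/-- `a m` commutes with the band generator of a pair of strings if and only if `{m, m + 1}` meets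
that pair in zero or two elements. -/
theorem commute_bandGenerator_iff (m i k : ℕ) (hm : m + 1 < n) (hk : i + k + 1 < n) :
    Commute (a m) (bandGenerator a i k) ↔
      ((m = i ∨ m = i + k + 1) ↔ (m + 1 = i ∨ m + 1 = i + k + 1)) := by
  rcases lt_trichotomy (m + 1) i with h1 | rfl | h1
  · exact iff_of_true (h.commute_of_lt _ _ _ h1 hk) (by omega)
  · exact iff_of_false (h.not_commute_left _ _ hk) (by omega)
  rcases lt_trichotomy m (i + k + 1) with h2 | rfl | h2
  rotate_left
  · exact iff_of_false (h.not_commute_right _ _ hm) (by omega)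
  · exact iff_of_true (h.commute_of_gt _ _ _ h2 hm) (by omega)
  obtain _ | k := k
  · obtain rfl : m = i := by omega
    exact iff_of_true (Commute.refl _) (by omega)
  rcases (show i ≤ m by omega).eq_or_lt with rfl | h3
  · refine iff_of_false ?_ (by omega)
    rw [h.bandGenerator_succ _ _ (by omega), commute_inv_conj_iff (Commute.refl _)]
    exact h.not_commute_left _ _ (by omega)
  rcases (show m ≤ i + k + 1 by omega).eq_or_lt with rfl | h4
  · refine iff_of_false ?_ (by omega)
    rw [bandGenerator, commute_conj_iff (Commute.refl _)]
    exact h.not_commute_right _ _ (by omega)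
  obtain ⟨l, rfl⟩ : ∃ l, m = i + l + 1 := ⟨m - i - 1, by omega⟩
  obtain ⟨r, hr⟩ : ∃ r, k + 1 = l + 2 + r := ⟨k + 1 - (l + 2), by omega⟩
  rw [hr]
  exact iff_of_true (h.commute_between _ _ _ (by omega)) (by omega)

/-- Commutation with `a m` records whether membership in the pair of strings changes from `m` to `m
+ 1`. Equal patterns thus force the two pairs to be equal or complementary, and complementary pairs
exist only for `n = 4`. -/
theorem bandGenerator_injective (hn : 3 ≤ n) (hn4 : n ≠ 4) (i k i' k' : ℕ)
    (hk : i + k + 1 < n) (hk' : i' + k' + 1 < n)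
    (heq : bandGenerator a i k = bandGenerator a i' k') : i = i' ∧ k = k' := by
  have key : ∀ m, m + 1 < n → (((m = i ∨ m = i + k + 1) ↔ (m + 1 = i ∨ m + 1 = i + k + 1)) ↔
      ((m = i' ∨ m = i' + k' + 1) ↔ (m + 1 = i' ∨ m + 1 = i' + k' + 1))) := fun m hm => by
    rw [← h.commute_bandGenerator_iff m i k hm hk, ← h.commute_bandGenerator_iff m i' k' hm hk',
      heq]
  have swap : ∀ {P Q R S : Prop}, ((P ↔ Q) ↔ (R ↔ S)) → ((Q ↔ S) ↔ (P ↔ R)) := by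
    intro P Q R S
    by_cases P <;> by_cases Q <;> by_cases R <;> by_cases S <;> simp [*]
  have const : ∀ m, m < n → (((m = i ∨ m = i + k + 1) ↔ (m = i' ∨ m = i' + k' + 1)) ↔
      ((0 = i ∨ 0 = i + k + 1) ↔ (0 = i' ∨ 0 = i' + k' + 1))) := by
    intro m
    induction m with
    | zero => intro _; rfl
    | succ m ih =>
      intro hm
      rw [← ih (by omega)]
      exact swap (key m hm)
  by_cases h0 : (0 = i ∨ 0 = i + k + 1) ↔ (0 = i' ∨ 0 = i' + k' + 1)
  · have h1 := ((const i (by omega)).2 h0).1 (Or.inl rfl)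
    have h2 := ((const (i + k + 1) (by omega)).2 h0).1 (Or.inr rfl)
    omega
  · exfalso
    have hmem : ∀ m, m < n → m = i ∨ m = i + k + 1 ∨ m = i' ∨ m = i' + k' + 1 := by
      intro m hm
      have := const m hm
      tauto
    have hsub : Finset.range n ⊆ {i, i + k + 1, i', i' + k' + 1} := fun m hm => by
      simpa using hmem m (Finset.mem_range.1 hm)
    have h4 := (Finset.card_le_card hsub).trans Finset.card_le_four
    rw [Finset.card_range] at h4
    obtain rfl : n = 3 := by omega
    have h1 := const i (by omega)
    have h2 := const (i + k + 1) (by omega)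
    have h3 := const i' (by omega)
    have h5 := const (i' + k' + 1) (by omega)
    omega

theorem isConj_apply (i : ℕ) (hi : i + 1 < n) : IsConj (a 0) (a i) := by
  induction i with
  | zero => exact IsConj.refl _
  | succ i ih =>
    refine (ih (by omega)).trans (isConj_iff.2 ⟨a i * a (i + 1), ?_⟩)
    rw [mul_inv_eq_iff_eq_mul, h.braid i (by omega), mul_assoc]

theorem isConj_bandGenerator (i k : ℕ) (hk : i + k + 1 < n) :
    IsConj (a 0) (bandGenerator a i k) := by
  induction k with
  | zero => exact h.isConj_apply i hk
  | succ k ih => exact (ih (by omega)).trans (isConj_iff.2 ⟨_, rfl⟩)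

end IsBraidTuple

/-! ### Lower bounds for finite groups containing a braid tuple. -/

theorem card_mul_card_centralizer_le [Finite G] (x : G) (T : Finset G)
    (hT : ∀ t ∈ T, IsConj x t) :
    T.card * Nat.card (Subgroup.centralizer {x}) ≤ Nat.card G := by
  have : ∀ t : T, ∃ g : G, g * x * g⁻¹ = t := fun t => isConj_iff.1 (hT t t.2)
  choose g hg using this
  rw [← Nat.card_eq_finsetCard, ← Nat.card_prod]
  -- Orbit-stabilizer as an injection: `g t * c` conjugates `x` to `t`, so it determines `t` and
  -- then `c`.
  refine Nat.card_le_card_of_injective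
    (fun p : T × Subgroup.centralizer {x} => g p.1 * (p.2 : G)) ?_
  rintro ⟨s, c, hc⟩ ⟨t, d, hd⟩ (hst : g s * c = g t * d)
  have hconj : ∀ (t : T) (c : G), c ∈ Subgroup.centralizer {x} →
      (g t * c) * x * (g t * c)⁻¹ = t := fun t c hc => by
    rw [← hg t]
    have := Subgroup.mem_centralizer_singleton_iff.1 hc
    calc _ = g t * (c * x) * c⁻¹ * (g t)⁻¹ := by group
      _ = _ := by rw [this]; group
  obtain rfl : s = t := Subtype.ext (by rw [← hconj s c hc, hst, hconj t d hd])
  simpa using hst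

namespace IsBraidTuple

variable {n : ℕ} {a : ℕ → G} (h : IsBraidTuple n a)
include h

theorem choose_two_mul_card_centralizer_le [Finite G] (hn : 3 ≤ n) (hn4 : n ≠ 4) :
    n.choose 2 * Nat.card (Subgroup.centralizer {a 0}) ≤ Nat.card G := by
  classical
  let S : Finset (Σ _ : ℕ, ℕ) := (Finset.range n).sigma fun j => Finset.range j
  let F : (Σ _ : ℕ, ℕ) → G := fun p => bandGenerator a (p.1 - p.2 - 1) p.2
  have hS : ∀ p ∈ S, p.1 < n ∧ p.2 < p.1 := fun p hp => by simpa [S] using hp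
  have hcard : (S.image F).card = n.choose 2 := by
    rw [Finset.card_image_of_injOn, Finset.card_sigma]
    · simp [Finset.sum_range_id, Nat.choose_two_right]
    · rintro ⟨j, k⟩ hp ⟨j', k'⟩ hp' heq
      have h1 := hS _ hp
      have h2 := hS _ hp'
      simp only at h1 h2
      change bandGenerator a (j - k - 1) k = bandGenerator a (j' - k' - 1) k' at heq
      obtain ⟨e1, rfl⟩ := h.bandGenerator_injective hn hn4 _ _ _ _ (by omega) (by omega) heq
      obtain rfl : j = j' := by omega
      rfl
  rw [← hcard]
  refine card_mul_card_centralizer_le _ _ fun t ht => ?_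
  obtain ⟨p, hp, rfl⟩ := Finset.mem_image.1 ht
  have := hS _ hp
  exact h.isConj_bandGenerator _ _ (by omega)

end IsBraidTuple

namespace IsBraidTuple

theorem four_le_card_centralizer [Finite G] {b : ℕ → G} (h : IsBraidTuple 4 b)
    (hne : b 0 ≠ b 2) : 4 ≤ Nat.card (Subgroup.centralizer {b 0}) := by
  classical
  have h01 := h.braid 0 (by omega)
  have h12 := h.braid 1 (by omega)
  have hxy := h.comm 0 2 (by omega) (by omega)
  have hxz := h.not_comm 0 (by omega)
  have hzy := h.not_comm 1 (by omega)
  simp only [zero_add, Nat.reduceAdd] at *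
  generalize b 0 = x at *
  generalize b 1 = z at *
  generalize b 2 = y at *
  have hx1 : x ≠ 1 := fun e => hxz (e ▸ Commute.one_left z)
  have hy1 : y ≠ 1 := fun e => hzy (e ▸ Commute.one_right z)
  suffices ∃ T : Finset G, T.card = 4 ∧ ∀ t ∈ T, Commute t x by
    obtain ⟨T, hT, hTc⟩ := this
    rw [← hT, ← Nat.card_eq_finsetCard]
    exact Nat.card_le_card_of_injective
      (fun t : T => (⟨t, Subgroup.mem_centralizer_singleton_iff.2 (hTc t t.2).eq⟩ :
        Subgroup.centralizer {x}))
      fun s t hst => Subtype.ext (congrArg (fun u : Subgroup.centralizer {x} => (u : G)) hst)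
  by_cases hprod : x * y = 1
  · obtain rfl : y = x⁻¹ := (inv_eq_of_mul_eq_one_right hprod).symm
    have hxx : x * x ≠ 1 := fun e => hne (eq_inv_of_mul_eq_one_left e)
    -- If `x` had cube 1, the braid relations of `z` with both `x` and `x⁻¹` would force `x = z⁻¹`,
    -- contradicting non-commutation.
    have hxxx : x * x ≠ x⁻¹ := by
      intro e
      have e1 : x * z * x⁻¹ = x⁻¹ * z⁻¹ * x := by
        have e2 : z * x * z⁻¹ = x⁻¹ * z * x := by
          rw [mul_inv_eq_iff_eq_mul, mul_assoc, mul_assoc, eq_inv_mul_iff_mul_eq, ← mul_assoc,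
            ← mul_assoc, h01]
        have e3 : z * x⁻¹ * z⁻¹ = x * z * x⁻¹ := by
          rw [mul_inv_eq_iff_eq_mul]
          have : x * (z * x⁻¹ * z) = z * x⁻¹ := by rw [h12]; group
          rw [← this]; group
        have e4 := congrArg (fun u => u⁻¹) e2
        simp only [mul_inv_rev, inv_inv, ← mul_assoc] at e4
        rw [← e3, e4]
      have e5 : x⁻¹ * z * x = z⁻¹ := by
        have : x * x * z * (x * x)⁻¹ = z⁻¹ := by
          calc _ = x * (x * z * x⁻¹) * x⁻¹ := by group
            _ = _ := by rw [e1]; group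
        rwa [e, inv_inv] at this
      have e6 : x = z⁻¹ := by
        have : x⁻¹ * (z * x * z) = z⁻¹ * z := by rw [← e5]; group
        rw [← h01] at this
        have : z * x = 1 := by simpa [mul_assoc] using this
        exact (inv_eq_of_mul_eq_one_right this).symm
      exact hxz (e6 ▸ (Commute.refl z).inv_left)
    refine ⟨{1, x, x⁻¹, x * x}, ?_, ?_⟩
    · rw [Finset.card_insert_of_notMem, Finset.card_insert_of_notMem,
        Finset.card_insert_of_notMem, Finset.card_singleton]
      all_goals simp_all [eq_comm]
    · simp [Commute, SemiconjBy, mul_assoc]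
  · refine ⟨{1, x, y, x * y}, ?_, ?_⟩
    · rw [Finset.card_insert_of_notMem, Finset.card_insert_of_notMem,
        Finset.card_insert_of_notMem, Finset.card_singleton]
      all_goals simp_all [eq_comm]
    · simp only [Finset.mem_insert, Finset.mem_singleton]
      rintro t (rfl | rfl | rfl | rfl)
      exacts [Commute.one_left _, Commute.refl _, hxy.symm, (Commute.refl _).mul_left hxy.symm]

/-- Six distinct conjugates of `b 0` times a centralizer of order at least 4. Commutation patterns
do not separate complementary pairs of strings here, so `b 0 ≠ b 2` is needed to separate them. -/
theorem twenty_four_le_card [Finite G] {b : ℕ → G} (h : IsBraidTuple 4 b) (hne : b 0 ≠ b 2) :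
    24 ≤ Nat.card G := by
  classical
  let x := b 0
  let z := b 1
  let y := b 2
  have h01 : x * z * x = z * x * z := h.braid 0 (by omega)
  have h12 : z * y * z = y * z * y := h.braid 1 (by omega)
  have hxy : Commute x y := h.comm 0 2 (by omega) (by omega)
  have hxz : ¬ Commute x z := h.not_comm 0 (by omega)
  have hzy : ¬ Commute z y := h.not_comm 1 (by omega)
  have hw : bandGenerator b 0 2 = y * (z * x * z⁻¹) * y⁻¹ := rfl
  set w := bandGenerator b 0 2
  have hxw : ¬ Commute x w := by
    rw [h.commute_bandGenerator_iff 0 0 2 (by omega) (by omega)]; omega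
  have hzw : Commute z w := (h.commute_bandGenerator_iff 1 0 2 (by omega) (by omega)).2 (by omega)
  have hu : z * x * z⁻¹ = x⁻¹ * z * x := by
    rw [mul_inv_eq_iff_eq_mul, mul_assoc, mul_assoc, eq_inv_mul_iff_mul_eq, ← mul_assoc,
      ← mul_assoc, h01]
  have hv : z * y * z⁻¹ = y⁻¹ * z * y := by
    rw [mul_inv_eq_iff_eq_mul, mul_assoc, mul_assoc, eq_inv_mul_iff_mul_eq, ← mul_assoc,
      ← mul_assoc, ← h12]
  -- If `w = z`, then `z` commutes with `y * x⁻¹`; expanding the conjugate of `y * x⁻¹` by `z`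
  -- through `hu` and `hv` gives `y = x`.
  have hwz : w ≠ z := by
    intro e
    rw [hw, hu] at e
    have hc : z * (y * x⁻¹) * z⁻¹ = y * x⁻¹ := by
      rw [mul_inv_eq_iff_eq_mul]
      nth_rewrite 1 [← e]
      group
    have e2 : (z * y * z⁻¹) * (z * x * z⁻¹)⁻¹ = y * x⁻¹ := by rw [← hc]; group
    rw [hu, hv] at e2
    have e3 : y⁻¹ * (z * (y * x⁻¹) * z⁻¹) * x = y * x⁻¹ :=
      (by group : _ = y⁻¹ * z * y * (x⁻¹ * z * x)⁻¹).trans e2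
    rw [hc] at e3
    exact hne (eq_of_mul_inv_eq_one (by simpa using e3.symm)).symm
  set u := z * x * z⁻¹
  set v := z * y * z⁻¹
  have huv : u ≠ v := by simpa [u, v] using hne
  have hxu : ¬ Commute x u := by rwa [hu, commute_inv_conj_iff (Commute.refl _)]
  have hzu : ¬ Commute z u := by
    rw [commute_conj_iff (Commute.refl _)]; exact fun hc => hxz hc.symm
  have hzv : ¬ Commute z v := by rwa [commute_conj_iff (Commute.refl _)]
  have hxv : ¬ Commute x v := by rwa [hv, commute_inv_conj_iff hxy]
  have hcard : ({x, y, z, w, u, v} : Finset G).card = 6 := by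
    have hxx := Commute.refl x
    have hzz := Commute.refl z
    have hyx : x ≠ y := hne
    have hzx : ¬ Commute z x := fun hc => hxz hc.symm
    rw [Finset.card_insert_of_notMem, Finset.card_insert_of_notMem, Finset.card_insert_of_notMem,
      Finset.card_insert_of_notMem, Finset.card_insert_of_notMem, Finset.card_singleton]
    all_goals
      simp only [Finset.mem_insert, Finset.mem_singleton, not_or]
      grind
  have := card_mul_card_centralizer_le x {x, y, z, w, u, v} (by
    have hy : IsConj x y := h.isConj_apply 2 (by omega)
    simp only [Finset.mem_insert, Finset.mem_singleton]
    rintro t (rfl | rfl | rfl | rfl | rfl | rfl)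
    exacts [IsConj.refl _, hy, h.isConj_apply 1 (by omega), h.isConj_bandGenerator 0 2 (by omega),
      isConj_iff.2 ⟨_, rfl⟩, hy.trans (isConj_iff.2 ⟨_, rfl⟩)])
  rw [hcard] at this
  have : 4 ≤ Nat.card (Subgroup.centralizer {x}) := h.four_le_card_centralizer hne
  omega

/-- `Q` is the centralizer of `a 0` modulo `⟨a 0⟩`, and `b i` is the class of `a (i + 2)`.
Neighbours that commute in `Q` coincide there by the braid relation; their lifts then differ by a
power of `a 0`, so the lifts commute too, which is excluded. -/
theorem exists_quotient_tuple {n : ℕ} {a : ℕ → G} (h : IsBraidTuple (n + 2) a) [Finite G] :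
    ∃ (Q : Type u) (_ : Group Q) (_ : Finite Q) (b : ℕ → Q),
      Nat.card (Subgroup.centralizer {a 0}) = orderOf (a 0) * Nat.card Q ∧ IsBraidTuple n b ∧
      ∀ i j, i + 1 < n → j + 1 < n → b i = b j →
        (a (i + 2))⁻¹ * a (j + 2) ∈ Subgroup.zpowers (a 0) := by
  classical
  let C := Subgroup.centralizer {a 0}
  let Z : Subgroup C := (Subgroup.zpowers (a 0)).subgroupOf C
  have hle : Subgroup.zpowers (a 0) ≤ C :=
    Subgroup.zpowers_le.2 (Subgroup.mem_centralizer_singleton_iff.2 rfl)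
  have hZ : Z.Normal := by
    refine ⟨fun z hz g => ?_⟩
    obtain ⟨k, hk⟩ := Subgroup.mem_zpowers_iff.1 (Subgroup.mem_subgroupOf.1 hz)
    have hg : Commute (g : G) (z : G) := by
      rw [← hk]
      exact Commute.zpow_right (Subgroup.mem_centralizer_singleton_iff.1 g.2) k
    have : g * z * g⁻¹ = z := by
      rw [mul_inv_eq_iff_eq_mul]
      exact Subtype.ext hg
    rwa [this]
  have hmem : ∀ i, i + 1 < n → a (i + 2) ∈ C := fun i hi =>
    Subgroup.mem_centralizer_singleton_iff.2 (h.comm 0 (i + 2) (by omega) (by omega)).eq.symm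
  let c : ℕ → C := fun i => if hi : i + 1 < n then ⟨a (i + 2), hmem i hi⟩ else 1
  have hc : ∀ i, i + 1 < n → (c i : G) = a (i + 2) := fun i hi => by simp [c, hi]
  have hb : ∀ i j, i + 1 < n → j + 1 < n → (c i : C ⧸ Z) = c j →
      (a (i + 2))⁻¹ * a (j + 2) ∈ Subgroup.zpowers (a 0) := fun i j hi hj hij => by
    have := Subgroup.mem_subgroupOf.1 (QuotientGroup.eq.1 hij)
    simpa [hc i hi, hc j hj] using this
  have hbraid : ∀ i, i + 2 < n → (c i : C ⧸ Z) * c (i + 1) * c i = c (i + 1) * c i * c (i + 1) := by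
    intro i hi
    refine congrArg (fun u : C => (u : C ⧸ Z)) (Subtype.ext ?_ :
      c i * c (i + 1) * c i = c (i + 1) * c i * c (i + 1))
    simpa [hc i (by omega), hc (i + 1) (by omega)] using h.braid (i + 2) (by omega)
  refine ⟨C ⧸ Z, inferInstance, inferInstance, fun i => (c i : C ⧸ Z), ?_,
    ⟨hbraid, fun i j hij hj => ?_, fun i hi hcomm => ?_⟩, hb⟩
  · rw [Subgroup.card_eq_card_quotient_mul_card_subgroup Z, mul_comm,
      Nat.card_congr (Subgroup.subgroupOfEquivOfLe hle).toEquiv, Nat.card_zpowers]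
  · refine congrArg (fun u : C => (u : C ⧸ Z)) (Subtype.ext ?_ : c i * c j = c j * c i)
    simpa [hc i (by omega), hc j (by omega)] using (h.comm (i + 2) (j + 2) (by omega) (by omega)).eq
  · obtain ⟨k, hk⟩ := Subgroup.mem_zpowers_iff.1
      (hb i (i + 1) (by omega) (by omega) (eq_of_braid_of_commute (hbraid i hi) hcomm))
    have h1 : Commute (a (i + 2)) ((a (i + 2))⁻¹ * a (i + 1 + 2)) := by
      rw [← hk]
      exact (h.comm 0 (i + 2) (by omega) (by omega)).symm.zpow_right k
    have h2 : Commute (a (i + 2)) (a (i + 1 + 2)) := by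
      simpa using (Commute.refl (a (i + 2))).mul_right h1
    exact h.not_comm (i + 2) (by omega) h2

/-- A finite group containing non-commuting elements which satisfy the Artin relations on
`n ≥ 3` strings, `n ≠ 4`, has at least `n! * r / 2` elements, where `r` is the order of the first
of them. -/
theorem factorial_mul_orderOf_le [Finite G] {n : ℕ} {a : ℕ → G} (h : IsBraidTuple n a)
    (hn : 3 ≤ n) (hn4 : n ≠ 4) : n.factorial * orderOf (a 0) ≤ 2 * Nat.card G := by
  induction n using Nat.strong_induction_on generalizing G with
  | _ n ih =>
  obtain ⟨m, rfl⟩ : ∃ m, n = m + 2 := ⟨n - 2, by omega⟩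
  obtain ⟨Q, _, _, b, hcard, hb, heq⟩ := h.exists_quotient_tuple
  have hQ : m.factorial ≤ Nat.card Q := by
    obtain rfl | rfl | ⟨h3, h4⟩ : m = 1 ∨ m = 4 ∨ (3 ≤ m ∧ m ≠ 4) := by omega
    · exact Nat.card_pos
    -- If `b 0 = b 2`, then `a 4 = a 2 * a 0 ^ k`. Comparing the braid relations of `a 3` with `a 2`
    -- and `a 4` gives `a 0 ^ k = 1`, so `a 4 = a 2`; but only `a 4` commutes with `a 1`.
    · refine hb.twenty_four_le_card fun h02 => ?_
      obtain ⟨k, hk⟩ := Subgroup.mem_zpowers_iff.1 (heq 0 2 (by omega) (by omega) h02)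
      simp only [zero_add, Nat.reduceAdd] at hk
      have hc : Commute (a 3) (a 0 ^ k) := (h.comm 0 3 (by omega) (by omega)).symm.zpow_right k
      have hc2 : Commute (a 2) (a 0 ^ k) := (h.comm 0 2 (by omega) (by omega)).symm.zpow_right k
      have e4 : a 4 = a 2 * a 0 ^ k := by rw [hk]; group
      have h23 := h.braid 2 (by omega)
      have h34 := h.braid 3 (by omega)
      simp only [Nat.reduceAdd] at h23 h34
      have h14 := h.comm 1 4 (by omega) (by omega)
      have h12 := h.not_comm 1 (by omega)
      simp only [Nat.reduceAdd] at h12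
      have hz : a 0 ^ k = 1 := by
        rw [e4] at h34
        generalize a 0 ^ k = z at *
        have e5 : a 3 * (a 2 * z) * a 3 = (a 3 * a 2 * a 3) * z := by
          simp only [mul_assoc]; rw [hc.eq]
        have e6 : a 2 * z * a 3 * (a 2 * z) = (a 2 * a 3 * a 2) * z * z := by
          have := (hc.mul_left hc2).eq
          calc _ = a 2 * (z * (a 3 * a 2)) * z := by group
            _ = _ := by rw [← this]; group
        rw [e5, e6, h23] at h34
        simpa using h34
      rw [e4, hz, mul_one] at h14
      exact h12 h14
    · have h1 := ih m (by omega) hb h3 h4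
      -- The order of `b 0` absorbs the factor 2 in the inductive bound.
      have h2 : 2 ≤ orderOf (b 0) := by
        have h0 : orderOf (b 0) ≠ 0 := (orderOf_pos _).ne'
        have h1 : orderOf (b 0) ≠ 1 := fun e =>
          hb.not_comm 0 (by omega) (orderOf_eq_one_iff.1 e ▸ Commute.one_left _)
        omega
      have := Nat.mul_le_mul_left m.factorial h2
      omega
  have h1 := h.choose_two_mul_card_centralizer_le hn hn4
  rw [hcard] at h1
  have h2 : 2 * (m + 2).choose 2 = (m + 2) * (m + 1) := by
    rw [Nat.choose_two_right, Nat.mul_div_cancel']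
    · rfl
    · exact (Nat.even_mul_pred_self (m + 2)).two_dvd
  calc (m + 2).factorial * orderOf (a 0)
      = 2 * ((m + 2).choose 2 * (orderOf (a 0) * m.factorial)) := by
        rw [Nat.factorial_succ, Nat.factorial_succ, ← mul_assoc 2, h2]; ring
    _ ≤ 2 * ((m + 2).choose 2 * (orderOf (a 0) * Nat.card Q)) := by gcongr
    _ ≤ 2 * Nat.card G := by gcongr

end IsBraidTuple

end BraidTuples

/-! ### The upper bound `n!` by coset enumeration, and collapse of commuting neighbours. -/

section CoxeterCount

variable {G : Type*} [Group G]

/-- The subgroup generated by the first `n - 1` terms of a sequence. -/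
def initialClosure (a : ℕ → G) (n : ℕ) : Subgroup G :=
  Subgroup.closure {x | ∃ i, i + 1 < n ∧ a i = x}

/-- The product `a (n - 1) * a (n - 2) * ⋯ * a (n - d)`. -/
def descendingProduct (a : ℕ → G) (n : ℕ) : ℕ → G
  | 0 => 1
  | d + 1 => descendingProduct a n d * a (n - d - 1)

theorem apply_mem_initialClosure (a : ℕ → G) {i n : ℕ} (h : i + 1 < n) :
    a i ∈ initialClosure a n :=
  Subgroup.subset_closure ⟨i, h, rfl⟩

section

variable {n : ℕ} {a : ℕ → G}

theorem commute_descendingProduct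
    (hcomm : ∀ i j, i + 2 ≤ j → j < n → Commute (a i) (a j))
    {m d : ℕ} (hd : d ≤ n) (hm : m + 1 < n - d) : Commute (a m) (descendingProduct a n d) := by
  induction d with
  | zero => exact Commute.one_right _
  | succ d ih =>
    exact (ih (by omega) (by omega)).mul_right (hcomm _ _ (by omega) (by omega))

theorem descendingProduct_mul
    (hbraid : ∀ i, i + 1 < n → a i * a (i + 1) * a i = a (i + 1) * a i * a (i + 1))
    (hcomm : ∀ i j, i + 2 ≤ j → j < n → Commute (a i) (a j))
    {k d : ℕ} (hd : d + k + 2 ≤ n) :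
    descendingProduct a n (d + k + 2) * a (n - d - 1) =
      a (n - d - 2) * descendingProduct a n (d + k + 2) := by
  induction k with
  | zero =>
    have hb := hbraid (n - d - 2) (by omega)
    have hc := commute_descendingProduct hcomm (m := n - d - 2) (d := d) (by omega) (by omega)
    simp only [descendingProduct, show n - (d + 1) - 1 = n - d - 2 by omega]
    rw [show n - d - 2 + 1 = n - d - 1 by omega] at hb
    rw [mul_assoc, mul_assoc, ← mul_assoc (a (n - d - 1)), ← hb]
    simp only [← mul_assoc]
    rw [hc.eq]
  | succ k ih =>
    have hc : Commute (a (n - (d + k + 2) - 1)) (a (n - d - 1)) := hcomm _ _ (by omega) (by omega)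
    rw [show d + (k + 1) + 2 = (d + k + 2) + 1 by omega, descendingProduct, mul_assoc, hc.eq,
      ← mul_assoc, ih (by omega), mul_assoc]

/-- The `n + 1` right cosets of `initialClosure a n` represented by descending products are permuted
by right multiplication by generators: `a m` passes through, lengthens the product, cancels its last
factor, or comes out on the left as `a (m - 1)`. -/
theorem exists_mul_descendingProduct
    (hbraid : ∀ i, i + 1 < n → a i * a (i + 1) * a i = a (i + 1) * a i * a (i + 1))
    (hcomm : ∀ i j, i + 2 ≤ j → j < n → Commute (a i) (a j))
    (hsq : ∀ i, i < n → a i * a i = 1) {x : G} (hx : x ∈ initialClosure a (n + 1)) :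
    ∃ h ∈ initialClosure a n, ∃ d ≤ n, x = h * descendingProduct a n d := by
  have step : ∀ x, (∃ h ∈ initialClosure a n, ∃ d ≤ n, x = h * descendingProduct a n d) →
      ∀ y ∈ {x | ∃ i, i + 1 < n + 1 ∧ a i = x},
        ∃ h ∈ initialClosure a n, ∃ d ≤ n, x * y = h * descendingProduct a n d := by
    rintro _ ⟨h, hh, d, hd, rfl⟩ _ ⟨m, hm, rfl⟩
    obtain h1 | h1 | h1 | h1 : m + 1 < n - d ∨ m + 1 = n - d ∨ m = n - d ∨ n - d < m := by omega
    · refine ⟨h * a m, mul_mem hh (apply_mem_initialClosure a (by omega)), d, hd, ?_⟩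
      rw [mul_assoc, mul_assoc, (commute_descendingProduct hcomm hd h1).eq]
    · refine ⟨h, hh, d + 1, by omega, ?_⟩
      rw [descendingProduct, mul_assoc, show n - d - 1 = m by omega]
    · obtain ⟨d, rfl⟩ : ∃ e, d = e + 1 := ⟨d - 1, by omega⟩
      refine ⟨h, hh, d, by omega, ?_⟩
      rw [descendingProduct, show n - d - 1 = m by omega, mul_assoc, mul_assoc, hsq m (by omega),
        mul_one]
    · obtain ⟨e, rfl⟩ : ∃ e, m = n - e - 1 := ⟨n - m - 1, by omega⟩
      obtain ⟨k, rfl⟩ : ∃ k, d = e + k + 2 := ⟨d - e - 2, by omega⟩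
      refine ⟨h * a (n - e - 2), mul_mem hh (apply_mem_initialClosure a (by omega)), _, hd, ?_⟩
      rw [mul_assoc, mul_assoc, descendingProduct_mul hbraid hcomm hd]
  refine Subgroup.closure_induction_right
    (p := fun x _ => ∃ h ∈ initialClosure a n, ∃ d ≤ n, x = h * descendingProduct a n d)
    ⟨1, one_mem _, 0, by omega, by simp [descendingProduct]⟩
    (fun x _ y hy h => step x h y hy) (fun x _ y hy h => ?_) hx
  have : y⁻¹ = y := by
    obtain ⟨m, hm, rfl⟩ := hy
    exact inv_eq_of_mul_eq_one_right (hsq m (by omega))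
  rw [this]
  exact step x h y hy

end

/-- Involutions satisfying the Artin relations on `n` strings generate a group of order at
most `n!`. -/
theorem card_initialClosure_le [Finite G] {n : ℕ} {a : ℕ → G}
    (hbraid : ∀ i, i + 2 < n → a i * a (i + 1) * a i = a (i + 1) * a i * a (i + 1))
    (hcomm : ∀ i j, i + 2 ≤ j → j + 1 < n → Commute (a i) (a j))
    (hsq : ∀ i, i + 1 < n → a i * a i = 1) :
    Nat.card (initialClosure a n) ≤ n.factorial := by
  induction n with
  | zero => simp [initialClosure]
  | succ n ih =>
    have key : ∀ x : initialClosure a (n + 1),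
        ∃ p : initialClosure a n × Fin (n + 1), (x : G) = p.1 * descendingProduct a n p.2 := by
      rintro ⟨x, hx⟩
      obtain ⟨h, hh, d, hd, rfl⟩ := exists_mul_descendingProduct
        (fun i hi => hbraid i (by omega)) (fun i j hi hj => hcomm i j hi (by omega))
        (fun i hi => hsq i (by omega)) hx
      exact ⟨(⟨h, hh⟩, ⟨d, by omega⟩), rfl⟩
    choose F hF using key
    have h1 := Nat.card_le_card_of_injective F fun x y hxy =>
      Subtype.ext (by rw [hF x, hF y, hxy])
    rw [Nat.card_prod, Nat.card_fin] at h1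
    have h2 := ih (fun i hi => hbraid i (by omega)) (fun i j hi hj => hcomm i j hi (by omega))
      (fun i hi => hsq i (by omega))
    rw [Nat.factorial_succ, mul_comm]
    exact h1.trans (Nat.mul_le_mul_right _ h2)

theorem initialClosure_le_zpowers {n : ℕ} {a : ℕ → G} (hn : ∀ i, i + 1 < n → a i = a 0) :
    initialClosure a n ≤ Subgroup.zpowers (a 0) := by
  refine (Subgroup.closure_le _).2 ?_
  rintro _ ⟨i, hi, rfl⟩
  rw [hn i hi]
  exact Subgroup.mem_zpowers _

/-- A commuting braided pair is equal, and the far commutation relations then make each adjacent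
pair commute in turn. The generated group is therefore cyclic, which excludes commuting neighbours
in a nonabelian image. -/
theorem apply_eq_apply_zero {n : ℕ} {a : ℕ → G}
    (hbraid : ∀ i, i + 2 < n → a i * a (i + 1) * a i = a (i + 1) * a i * a (i + 1))
    (hcomm : ∀ i j, i + 2 ≤ j → j + 1 < n → Commute (a i) (a j))
    {k : ℕ} (hk : k + 2 < n) (hkc : Commute (a k) (a (k + 1))) :
    ∀ i, i + 1 < n → a i = a 0 := by
  have hup : ∀ i, i + 2 < n → a i = a (i + 1) → ∀ j, i + j + 2 < n →
      a (i + j) = a (i + j + 1) := by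
    intro i hi hii j
    induction j with
    | zero => exact fun _ => hii
    | succ j ih =>
      intro hj
      refine eq_of_braid_of_commute (hbraid _ (by omega)) ?_
      rw [show i + (j + 1) = i + j + 1 by omega, ← ih (by omega)]
      exact hcomm _ _ (by omega) (by omega)
  have hdown : ∀ j, j + 2 < n → a j = a (j + 1) → a 0 = a 1 := by
    intro j
    induction j with
    | zero => exact fun _ h => h
    | succ j ih =>
      intro hj hjj
      refine ih (by omega) (eq_of_braid_of_commute (hbraid _ (by omega)) ?_)
      rw [hjj]
      exact hcomm _ _ (by omega) (by omega)
  have h0 := hdown k hk (eq_of_braid_of_commute (hbraid _ hk) hkc)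
  intro i
  induction i with
  | zero => exact fun _ => rfl
  | succ i ih =>
    intro hi
    rw [← ih (by omega)]
    simpa using (hup 0 (by omega) h0 i (by omega)).symm

end CoxeterCount

/-! ### Epimorphisms from the braid group onto the symmetric group. -/

namespace ProfiniteBraid

section

variable {G : Type*} [Group G] {n : ℕ} (f : BraidGroup n →* G)

/-- The images of the Artin generators, extended by `1`. -/
def generatorImage (i : ℕ) : G :=
  if h : i + 1 < n then f (PresentedGroup.of ⟨i, by omega⟩) else 1

theorem generatorImage_of_lt {i : ℕ} (h : i + 1 < n) :
    generatorImage f i = f (PresentedGroup.of ⟨i, by omega⟩) := by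
  simp [generatorImage, h]

theorem generatorImage_braid (i : ℕ) (h : i + 2 < n) :
    generatorImage f i * generatorImage f (i + 1) * generatorImage f i =
      generatorImage f (i + 1) * generatorImage f i * generatorImage f (i + 1) := by
  rw [generatorImage_of_lt f (show i + 1 < n by omega),
    generatorImage_of_lt f (show i + 1 + 1 < n by omega)]
  simp only [← map_mul]
  congr 1
  exact PresentedGroup.mk_eq_mk_of_mul_inv_mem
    (Or.inl ⟨⟨i, by omega⟩, ⟨i + 1, by omega⟩, rfl, rfl⟩)

theorem generatorImage_commute (i j : ℕ) (hij : i + 2 ≤ j) (h : j + 1 < n) :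
    Commute (generatorImage f i) (generatorImage f j) := by
  rw [generatorImage_of_lt f (show i + 1 < n by omega), generatorImage_of_lt f h, Commute,
    SemiconjBy]
  simp only [← map_mul]
  congr 1
  exact PresentedGroup.mk_eq_mk_of_mul_inv_mem
    (Or.inr ⟨⟨i, by omega⟩, ⟨j, by omega⟩, hij, rfl⟩)

theorem range_eq_initialClosure : f.range = initialClosure (generatorImage f) n := by
  rw [MonoidHom.range_eq_map, ← PresentedGroup.closure_range_of, MonoidHom.map_closure,
    initialClosure]
  congr 1
  ext x
  constructor
  · rintro ⟨_, ⟨i, rfl⟩, rfl⟩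
    exact ⟨i, by omega, generatorImage_of_lt f (by omega)⟩
  · rintro ⟨i, hi, rfl⟩
    exact ⟨_, ⟨⟨i, by omega⟩, rfl⟩, (generatorImage_of_lt f hi).symm⟩

end

theorem braidToPerm_of (n : ℕ) (i : Fin (n - 1)) :
    braidToPerm n (PresentedGroup.of i) = adjSwap n i :=
  PresentedGroup.toGroup.of _

theorem braidToPerm_surjective (n : ℕ) : Function.Surjective (braidToPerm n) := by
  obtain _ | n := n
  · exact fun x => ⟨1, Subsingleton.elim _ _⟩
  · rw [← MonoidHom.range_eq_top, eq_top_iff, ← Subgroup.toSubmonoid_le, Subgroup.top_toSubmonoid,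
      ← Equiv.Perm.mclosure_swap_castSucc_succ, Submonoid.closure_le]
    rintro _ ⟨i, rfl⟩
    exact ⟨PresentedGroup.of i, braidToPerm_of (n + 1) i⟩

theorem exists_not_commute_perm {n : ℕ} (hn : 3 ≤ n) :
    ∃ x y : Equiv.Perm (Fin n), x * y ≠ y * x := by
  refine ⟨Equiv.swap ⟨0, by omega⟩ ⟨1, by omega⟩, Equiv.swap ⟨1, by omega⟩ ⟨2, by omega⟩,
    fun h => ?_⟩
  have := congrArg (fun g : Equiv.Perm (Fin n) => g ⟨2, by omega⟩) h
  simp [Equiv.swap_apply_def] at this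

theorem generatorImage_sq {n : ℕ} (hn : 3 ≤ n) (hn4 : n ≠ 4)
    (f : BraidGroup n →* Equiv.Perm (Fin n)) (hf : Function.Surjective f) (i : ℕ)
    (hi : i + 1 < n) : generatorImage f i * generatorImage f i = 1 := by
  have hT : IsBraidTuple n (generatorImage f) := by
    refine ⟨generatorImage_braid f, generatorImage_commute f, fun k hk hc => ?_⟩
    have h1 := initialClosure_le_zpowers (apply_eq_apply_zero (generatorImage_braid f)
      (generatorImage_commute f) hk hc)
    rw [← range_eq_initialClosure, MonoidHom.range_eq_top.2 hf] at h1
    obtain ⟨x, y, hxy⟩ := exists_not_commute_perm hn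
    obtain ⟨p, rfl⟩ := Subgroup.mem_zpowers_iff.1 (h1 (Subgroup.mem_top x))
    obtain ⟨q, rfl⟩ := Subgroup.mem_zpowers_iff.1 (h1 (Subgroup.mem_top y))
    exact hxy (zpow_mul_comm _ _ _)
  have h1 := hT.factorial_mul_orderOf_le hn hn4
  rw [Nat.card_perm, Nat.card_fin, mul_comm] at h1
  -- The symmetric group has order exactly `n!`, which cancels in the counting bound.
  have h2 : orderOf (generatorImage f 0) ≤ 2 := Nat.le_of_mul_le_mul_right h1 n.factorial_pos
  have h3 : orderOf (generatorImage f 0) ∣ 2 := by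
    have := orderOf_pos (generatorImage f 0)
    interval_cases orderOf (generatorImage f 0) <;> norm_num
  have h4 := orderOf_dvd_iff_pow_eq_one.1 h3
  obtain ⟨c, hc⟩ := isConj_iff.1 (hT.isConj_apply i hi)
  rw [← pow_two, ← hc, conj_pow, h4]
  simp

/-- For `n ≠ 4`, every epimorphism from the braid group onto the symmetric group has the pure
braid group as its kernel. -/
theorem ker_eq_pureBraidGroup {n : ℕ} (hn : 3 ≤ n) (hn4 : n ≠ 4)
    (f : BraidGroup n →* Equiv.Perm (Fin n)) (hf : Function.Surjective f) :
    f.ker = pureBraidGroup n := by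
  let g := f.prod (braidToPerm n)
  have hg : ∀ i, i + 1 < n → generatorImage g i =
      (generatorImage f i, generatorImage (braidToPerm n) i) := fun i hi => by
    simp only [generatorImage_of_lt _ hi]; rfl
  have hcard : Nat.card g.range ≤ Nat.card (Equiv.Perm (Fin n)) := by
    rw [range_eq_initialClosure, Nat.card_perm, Nat.card_fin]
    refine card_initialClosure_le (generatorImage_braid g) (generatorImage_commute g)
      fun i hi => ?_
    rw [hg i hi, Prod.mk_mul_mk, generatorImage_sq hn hn4 f hf i hi,
      generatorImage_sq hn hn4 _ (braidToPerm_surjective n) i hi, Prod.mk_one_one]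
  -- A surjection from `g.range` onto a group at least as large is injective, so composing with `p`
  -- does not enlarge the kernel of `g`.
  have inj : ∀ p : Equiv.Perm (Fin n) × Equiv.Perm (Fin n) →* Equiv.Perm (Fin n),
      Function.Surjective (p.comp g) → (p.comp g).ker = g.ker := by
    intro p hp
    have hs : Function.Surjective (p.comp g.range.subtype) := fun y => by
      obtain ⟨x, rfl⟩ := hp y
      exact ⟨⟨g x, x, rfl⟩, rfl⟩
    have hi : Function.Injective (p.comp g.range.subtype) :=
      (hs.bijective_of_nat_card_le hcard).1
    ext x
    refine ⟨fun hx => ?_, fun hx => ?_⟩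
    · have : (⟨g x, x, rfl⟩ : g.range) = 1 := hi (by simpa using hx)
      exact congrArg Subtype.val this
    · rw [MonoidHom.mem_ker] at hx ⊢
      rw [MonoidHom.comp_apply, hx, map_one]
  exact (inj (MonoidHom.fst _ _) hf).trans (inj (MonoidHom.snd _ _) (braidToPerm_surjective n)).symm

end ProfiniteBraid

/-! ### Passage to profinite completions. -/

namespace ProfiniteBraid

open CategoryTheory

section

open ProfiniteGrp.ProfiniteCompletion

/-- The canonical homomorphism from a group to its profinite completion. -/
def toCompletion (Γ : Type) [Group Γ] :
    Γ →* ProfiniteGrp.profiniteCompletion.obj (GrpCat.of Γ) :=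
  (eta (GrpCat.of Γ)).hom

theorem denseRange_toCompletion (Γ : Type) [Group Γ] : DenseRange (toCompletion Γ) :=
  denseRange (GrpCat.of Γ)

theorem completion_lift_toCompletion {Γ : Type} [Group Γ] {P : ProfiniteGrp.{0}} (f : Γ →* P)
    (x : Γ) : (lift (G := GrpCat.of Γ) (GrpCat.ofHom f)).hom (toCompletion Γ x) = f x :=
  ConcreteCategory.congr_hom (lift_eta (G := GrpCat.of Γ) (GrpCat.ofHom f)) x

/-- The map of profinite completions induced by the inclusion of a subgroup has image the closure
of that subgroup. -/
theorem range_completion_map_subtype {Γ : Type} [Group Γ] (H : Subgroup Γ) :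
    Set.range (ProfiniteGrp.profiniteCompletion.map (GrpCat.ofHom H.subtype)).hom =
      closure (toCompletion Γ '' H) := by
  set φ := (ProfiniteGrp.profiniteCompletion.map (GrpCat.ofHom H.subtype)).hom with hφ
  have hcont : Continuous φ := φ.continuous_toFun
  have himage : φ '' Set.range (toCompletion H) = toCompletion Γ '' H := by
    have hx : ∀ x : H, φ (toCompletion H x) = toCompletion Γ x := fun x =>
      completion_lift_toCompletion ((toCompletion Γ).comp H.subtype) x
    ext y
    constructor
    · rintro ⟨_, ⟨x, rfl⟩, rfl⟩
      exact ⟨x, x.2, (hx x).symm⟩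
    · rintro ⟨x, hxH, rfl⟩
      exact ⟨_, ⟨⟨x, hxH⟩, rfl⟩, hx ⟨x, hxH⟩⟩
  refine Set.Subset.antisymm ?_ ?_
  · rw [← Set.image_univ, ← (denseRange_toCompletion H).closure_range, ← himage]
    exact image_closure_subset_closure_image hcont
  · refine closure_minimal ?_ (isCompact_range hcont).isClosed
    rw [← himage]
    exact Set.image_subset_range _ _

/-- The kernel of a continuous homomorphism to a discrete group is the closure of the kernel of
its restriction to a dense subgroup. -/
theorem ker_eq_closure {Γ : Type} [Group Γ] {P : ProfiniteGrp.{0}} [DiscreteTopology P]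
    (p : ProfiniteGrp.profiniteCompletion.obj (GrpCat.of Γ) ⟶ P) :
    (p.hom.toMonoidHom.ker : Set (ProfiniteGrp.profiniteCompletion.obj (GrpCat.of Γ))) =
      closure (toCompletion Γ '' (p.hom.toMonoidHom.comp (toCompletion Γ)).ker) := by
  have hcont : Continuous p.hom := p.hom.continuous_toFun
  have hker : (p.hom.toMonoidHom.ker :
      Set (ProfiniteGrp.profiniteCompletion.obj (GrpCat.of Γ))) = p.hom ⁻¹' {1} := rfl
  have himage : toCompletion Γ '' (p.hom.toMonoidHom.comp (toCompletion Γ)).ker =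
      p.hom ⁻¹' {1} ∩ Set.range (toCompletion Γ) := by
    ext y
    constructor
    · rintro ⟨x, hx, rfl⟩
      exact ⟨hx, x, rfl⟩
    · rintro ⟨hx, x, rfl⟩
      exact ⟨x, hx, rfl⟩
  rw [hker, himage]
  refine Set.Subset.antisymm ?_ ?_
  -- The kernel is open because the target is discrete, so the dense image of `Γ` meets it in a
  -- dense subset.
  · exact (denseRange_toCompletion Γ).open_subset_closure_inter
      ((isOpen_discrete _).preimage hcont)
  · exact closure_minimal Set.inter_subset_left (isClosed_singleton.preimage hcont)

end

instance (n : ℕ) : Finite (symmetricProfinite n) :=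
  inferInstanceAs (Finite (Equiv.Perm (Fin n)))

theorem coe_pureBraidHat (n : ℕ) : (pureBraidHat n : Set (braidHat n)) =
    closure (toCompletion (BraidModCenter n) '' pureBraidModCenter n) :=
  range_completion_map_subtype (pureBraidModCenter n)

theorem ker_eq_pureBraidHat {n : ℕ} (hn : 3 ≤ n) (hn4 : n ≠ 4)
    (p : braidHat n ⟶ symmetricProfinite n) (hp : Function.Surjective p.hom) :
    p.hom.toMonoidHom.ker = pureBraidHat n := by
  let q : BraidModCenter n →* Equiv.Perm (Fin n) :=
    p.hom.toMonoidHom.comp (toCompletion (BraidModCenter n))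
  have hq : Function.Surjective q := by
    have hd : DenseRange (p.hom ∘ toCompletion (BraidModCenter n)) :=
      hp.denseRange.comp (denseRange_toCompletion _) p.hom.continuous_toFun
    exact Set.range_eq_univ.1 ((closure_discrete (α := symmetricProfinite n) _).symm.trans
      hd.closure_range)
  have hker : q.ker = pureBraidModCenter n := by
    rw [pureBraidModCenter, ← ker_eq_pureBraidGroup hn hn4
      (q.comp (QuotientGroup.mk' (Subgroup.center (BraidGroup n))))
      (hq.comp (QuotientGroup.mk'_surjective _)), ← MonoidHom.comap_ker,
      Subgroup.map_comap_eq_self_of_surjective (QuotientGroup.mk'_surjective _)]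
  refine SetLike.coe_injective ?_
  rw [ker_eq_closure p, coe_pureBraidHat]
  exact congrArg (fun K : Subgroup (BraidModCenter n) =>
    closure (toCompletion (BraidModCenter n) '' K)) hker

theorem center_perm_eq_bot {n : ℕ} (hn : 3 ≤ n) : Subgroup.center (Equiv.Perm (Fin n)) = ⊥ := by
  refine (Subgroup.eq_bot_iff_forall _).2 fun g hg => Equiv.ext fun i => ?_
  by_contra hi
  obtain ⟨k, hki, hkg⟩ : ∃ k, k ≠ i ∧ k ≠ g i := by
    by_contra! hne
    have hsub : (Finset.univ : Finset (Fin n)) ⊆ {i, g i} := fun k _ => by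
      by_cases hk : k = i
      · simp [hk]
      · simp [hne k hk]
    have := (Finset.card_le_card hsub).trans Finset.card_le_two
    rw [Finset.card_fin] at this
    omega
  -- The transposition of `g i` and `k` fixes `i` but moves `g i`, so it cannot commute with `g`.
  have h := congrArg (fun s : Equiv.Perm (Fin n) => s i)
    (Subgroup.mem_center_iff.1 hg (Equiv.swap (g i) k))
  simp only [Equiv.Perm.mul_apply, Equiv.swap_apply_left] at h
  have hig : i ≠ g i := fun e => hi e.symm
  rw [Equiv.swap_apply_of_ne_of_ne hig hki.symm] at h
  exact hkg h

theorem center_le_pureBraidGroup {n : ℕ} (hn : 3 ≤ n) :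
    Subgroup.center (BraidGroup n) ≤ pureBraidGroup n := fun x hx => by
  have : braidToPerm n x ∈ Subgroup.center (Equiv.Perm (Fin n)) := by
    refine Subgroup.mem_center_iff.2 fun y => ?_
    obtain ⟨z, rfl⟩ := braidToPerm_surjective n y
    rw [← map_mul, ← map_mul, Subgroup.mem_center_iff.1 hx z]
  rw [center_perm_eq_bot hn] at this
  exact this

theorem exists_surjective_hom {n : ℕ} (hn : 3 ≤ n) :
    ∃ p : braidHat n ⟶ symmetricProfinite n, Function.Surjective p.hom := by
  let q : BraidModCenter n →* symmetricProfinite n :=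
    QuotientGroup.lift (Subgroup.center (BraidGroup n)) (braidToPerm n)
      (center_le_pureBraidGroup hn)
  refine ⟨ProfiniteGrp.ProfiniteCompletion.lift (GrpCat.ofHom q), fun y => ?_⟩
  obtain ⟨x, rfl⟩ := braidToPerm_surjective n y
  exact ⟨toCompletion _ (x : BraidModCenter n), completion_lift_toCompletion q _⟩

/-- An automorphism carries the kernel of an epimorphism `p` to the kernel of `p` composed with its
inverse, and both kernels are `pureBraidHat n`. The standard map supplies one such `p`. -/
theorem isCharacteristic_pureBraidHat {n : ℕ} (hn : 3 ≤ n) (hn4 : n ≠ 4) :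
    IsCharacteristic (pureBraidHat n) := by
  intro φ
  obtain ⟨p, hp⟩ := exists_surjective_hom hn
  let p' : braidHat n ⟶ symmetricProfinite n :=
    (ProfiniteGrp.ContinuousMulEquiv.toProfiniteGrpIso φ.symm).hom ≫ p
  have hp' : Function.Surjective p'.hom := hp.comp φ.symm.surjective
  rw [← ker_eq_pureBraidHat hn hn4 p' hp']
  nth_rewrite 1 [ker_eq_pureBraidHat hn hn4 p' hp', ← ker_eq_pureBraidHat hn hn4 p hp]
  ext x
  constructor
  · rintro ⟨y, hy, rfl⟩
    change p.hom (φ.symm (φ y)) = 1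
    rw [φ.symm_apply_apply]
    exact hy
  · intro hx
    exact ⟨φ.symm x, hx, φ.apply_symm_apply x⟩

end ProfiniteBraid

theorem mainTheorem7 (n : ℕ) (hn : 3 ≤ n) (hn4 : n ≠ 4) :
    (∀ p : ProfiniteBraid.braidHat n ⟶ ProfiniteBraid.symmetricProfinite n,
      Function.Surjective p.hom → p.hom.toMonoidHom.ker = ProfiniteBraid.pureBraidHat n) ∧
    ProfiniteBraid.IsCharacteristic (ProfiniteBraid.pureBraidHat n) :=
  ⟨fun p hp => ProfiniteBraid.ker_eq_pureBraidHat hn hn4 p hp,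
    ProfiniteBraid.isCharacteristic_pureBraidHat hn hn4⟩
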